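/- Let $D=(V,A)$ be a finite loopless digraph that is semicomplete, i.e. for any two distinct vertices $x,y$ at least one of $xy,yx$ is an arc. Let $Z_D=\{(x,y): xy\in A \text{ or } yx\in A\}$. For $(x,y),(x',y')\in Z_D$ write $(x,y)\,\Gamma\,(x',y')$ if one of the following holds: - $x=x'$ and $y=y'$; - $x=x'$, $y\ne y'$, and either $yx,x'y'\in A$ and $yy'\notin A$, or $y'x',xy\in A$ and $y'y\notin A$; - $y=y'$, $x\neq x'$, and either $xy,y'x'\in A$ and $xx'\notin A$, or $x'y',yx\in A$ and $x'x\notin A$. The equivalence classes of $Z_D$ under the transitive closure of $\Gamma$ are the implication classes of $D$; their set is $\mathcal I(D)$. For $I\subseteq Z_D$ put $I^{-1}=\{(y,x):(x,y)\in I\}$. A comparability ordering of $D$ is a strict linear order $\prec$ on $V$ such that for all $x\prec y\prec z$: if $xy,yz\in A$ then $xz\in A$, and if $zy,yx\in A$ then $zx\in A$. $D$ is a comparability digraph if it has a comparability ordering. Consider the following nondeterministic algorithm. 1. If $I=I^{-1}$ for some $I\in\mathcal I(D)$, halt with the answer "$D$ is not a comparability digraph". 2. Otherwise set $T=\emptyset$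 and $\mathcal C=\{I\in\mathcal I(D): |I|>1\}$. 3. While $\mathcal C\ne\emptyset$: if there are $(x,y),(y,z)\in T$ and $I\in\mathcal C$ with $(x,z)\in I$, choose any such $I$; otherwise choose an arbitrary $I\in\mathcal C$. Replace $T$ by $T\cup I$ and $\mathcal C$ by $\mathcal C\setminus\{I,I^{-1}\}$. 4. Return any strict linear order $\prec$ on $V$ such that $x\prec y$ for all $(x,y)\in T$. **Theorem.** Suppose that $I\ne I^{-1}$ for every $I\in\mathcal I(D)$. Then, whatever choices are made, the algorithm terminates (it has no infinite run), every run can be carried out to the end (in particular a linear order as required in step 4 exists), and every run returns a comparability ordering of $D$. Consequently $D$ is a comparability digraph. -/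

import Mathlib

namespace ComparabilityDigraph

variable {V : Type*}

/-- `D` is semicomplete: it has no loops, and any two distinct vertices are joined
by an arc in at least one direction (possibly both). -/
structure IsSemicomplete (D : Digraph V) : Prop where
  loopless : ∀ x, ¬ D.Adj x x
  total : ∀ x y, x ≠ y → D.Adj x y ∨ D.Adj y x

/-- The strict linear order `lt` of the vertices is a comparability ordering of `D`. -/
structure IsComparabilityOrdering (D : Digraph V) (lt : V → V → Prop) : Prop where
  ordering : IsStrictTotalOrder V lt
  forward : ∀ x y z, lt x y → lt y z → D.Adj x y → D.Adj y z → D.Adj x z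
  backward : ∀ x y z, lt x y → lt y z → D.Adj z y → D.Adj y x → D.Adj z x

/-- `D` is a comparability digraph. -/
def IsComparabilityDigraph (D : Digraph V) : Prop :=
  ∃ lt : V → V → Prop, IsComparabilityOrdering D lt

/-- `Z_D`: the ordered pairs of adjacent vertices of `D`. -/
def pairs (D : Digraph V) : Set (V × V) :=
  {p | D.Adj p.1 p.2 ∨ D.Adj p.2 p.1}

/-- The relation `Γ` on `Z_D`: the pair `p = (x, y)` directly forces the pair
`q = (x', y')`. -/
def DirectlyForces (D : Digraph V) (p q : V × V) : Prop :=
  p ∈ pairs D ∧ q ∈ pairs D ∧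
    ((p.1 = q.1 ∧ p.2 = q.2) ∨
     (p.1 = q.1 ∧ p.2 ≠ q.2 ∧
        ((D.Adj p.2 p.1 ∧ D.Adj q.1 q.2 ∧ ¬ D.Adj p.2 q.2) ∨
         (D.Adj q.2 q.1 ∧ D.Adj p.1 p.2 ∧ ¬ D.Adj q.2 p.2))) ∨
     (p.2 = q.2 ∧ p.1 ≠ q.1 ∧
        ((D.Adj p.1 p.2 ∧ D.Adj q.2 q.1 ∧ ¬ D.Adj p.1 q.1) ∨
         (D.Adj q.1 q.2 ∧ D.Adj p.2 p.1 ∧ ¬ D.Adj q.1 p.1))))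

/-- The set of implication classes of `D`: the equivalence classes of `Z_D` under the
transitive closure of `Γ`. -/
def implicationClasses (D : Digraph V) : Set (Set (V × V)) :=
  {I | ∃ p ∈ pairs D, I = {q | Relation.TransGen (DirectlyForces D) p q}}

/-- The inverse `{(y, x) | (x, y) ∈ I}` of a set of pairs. -/
def inverse (I : Set (V × V)) : Set (V × V) :=
  {p | (p.2, p.1) ∈ I}

/-- `I` contains a pair `(x, z)` such that `(x, y)` and `(y, z)` are in `T` for some `y`. -/
def ForcedBy (T I : Set (V × V)) : Prop :=
  ∃ x y z, (x, y) ∈ T ∧ (y, z) ∈ T ∧ (x, z) ∈ I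

/-- The states of the algorithm. -/
inductive State (V : Type*) where
  /-- before anything has been done -/
  | start
  /-- at the head of the while loop, with the current set `T` of pairs and the current
  set `C` of implication classes that are still to be treated -/
  | loop (T : Set (V × V)) (C : Set (Set (V × V)))
  /-- halted with the answer that the input is not a comparability digraph -/
  | rejected
  /-- halted with the vertex ordering `lt` as output -/
  | returned (lt : V → V → Prop)

/-- One step of the (nondeterministic) algorithm on input `D`. -/
inductive Step (D : Digraph V) : State V → State V → Prop
  /-- some implication class equals its inverse: reject -/
  | reject (h : ∃ I ∈ implicationClasses D, I = inverse I) :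
      Step D .start .rejected
  /-- otherwise start with `T = ∅` and all the implication classes with more than
  one element -/
  | init (h : ¬ ∃ I ∈ implicationClasses D, I = inverse I) :
      Step D .start (.loop ∅ {I | I ∈ implicationClasses D ∧ I.Nontrivial})
  /-- a class with a pair implied by the transitivity of `T` has priority -/
  | forced (T : Set (V × V)) (C : Set (Set (V × V))) (I : Set (V × V))
      (hI : I ∈ C) (h : ForcedBy T I) :
      Step D (.loop T C) (.loop (T ∪ I) (C \ {I, inverse I}))
  /-- if there is none, an arbitrary remaining class is chosen -/
  | free (T : Set (V × V)) (C : Set (Set (V × V))) (I : Set (V × V))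
      (hI : I ∈ C) (h : ¬ ∃ J ∈ C, ForcedBy T J) :
      Step D (.loop T C) (.loop (T ∪ I) (C \ {I, inverse I}))
  /-- when no class is left, return any vertex ordering that extends `T` -/
  | finish (T : Set (V × V)) (lt : V → V → Prop) (hlt : IsStrictTotalOrder V lt)
      (h : ∀ x y, (x, y) ∈ T → lt x y) :
      Step D (.loop T ∅) (.returned lt)

end ComparabilityDigraph

namespace ComparabilityDigraph

variable {V : Type*} {D : Digraph V}

/-! If `(y, x)` directly forces `(y, z)` with `x ≠ z`, then `y` should not lie between `x` and `z`.
Conversely, a linear order fails to be a comparability ordering only by putting such a `y` between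
`x` and `z`. So an order that contains each nontrivial class or its inverse is a comparability
ordering, and it remains to show that the choices of the algorithm never become cyclic.

Transitivity cannot be demanded of all pairs. Call a pair proper if its class is nontrivial or it is
joined by two arcs; the remaining pairs of distinct vertices are improper. A closed orientation is
an asymmetric union of classes of proper pairs, transitive whenever the resulting pair is proper.
Two facts control these: the triangle lemma (`IsConsistent.triangle`), which lets a pair move
through its class while its relation to a third vertex stays in the same classes, and
`cls_eq_of_improper`, by which two consecutive oriented pairs spanning an improper pair share a
class. From them, any undecided proper pair can be added (`isClosedOrientation_extend`), and a
closed orientation deciding all proper pairs is acyclic (`acyclic`).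

The loop invariant is that `T` lies in some closed orientation. A forced class already lies in it.
When no class is forced, `T` need only be completed by pairs with trivial classes to become closed
(`IsSaturated.exists_closed`), so any remaining class may be added. This is where the priority rule
is needed. -/

/-- The implication class of the pair `(x, y)`; it is empty when `x` and `y` are not adjacent. -/
def cls (D : Digraph V) (x y : V) : Set (V × V) :=
  {q | Relation.TransGen (DirectlyForces D) (x, y) q}

/-! ### Symmetries of forcing and types of pairs -/

theorem DirectlyForces.symm {p q : V × V} (h : DirectlyForces D p q) : DirectlyForces D q p := by
  obtain ⟨hp, hq, h⟩ := h
  refine ⟨hq, hp, ?_⟩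
  rcases h with ⟨h1, h2⟩ | ⟨h1, h2, h3⟩ | ⟨h1, h2, h3⟩
  · exact Or.inl ⟨h1.symm, h2.symm⟩
  · exact Or.inr (Or.inl ⟨h1.symm, h2.symm, h3.symm⟩)
  · exact Or.inr (Or.inr ⟨h1.symm, h2.symm, h3.symm⟩)

theorem DirectlyForces.swap {p q : V × V} (h : DirectlyForces D p q) :
    DirectlyForces D p.swap q.swap := by
  obtain ⟨hp, hq, h⟩ := h
  refine ⟨Or.symm hp, Or.symm hq, ?_⟩
  rcases h with ⟨h1, h2⟩ | ⟨h1, h2, h3⟩ | ⟨h1, h2, h3⟩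
  · exact Or.inl ⟨h2, h1⟩
  · refine Or.inr (Or.inr ⟨h1, h2, ?_⟩)
    simpa using h3
  · refine Or.inr (Or.inl ⟨h1, h2, ?_⟩)
    simpa using h3

theorem directlyForces_refl {p : V × V} (h : p ∈ pairs D) : DirectlyForces D p p :=
  ⟨h, h, Or.inl ⟨rfl, rfl⟩⟩

theorem transGen_symm {p q : V × V} (h : Relation.TransGen (DirectlyForces D) p q) :
    Relation.TransGen (DirectlyForces D) q p := by
  induction h with
  | single h => exact .single h.symm
  | tail _ h ih => exact .head h.symm ih

theorem transGen_swap {p q : V × V} (h : Relation.TransGen (DirectlyForces D) p q) :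
    Relation.TransGen (DirectlyForces D) p.swap q.swap := by
  induction h with
  | single h => exact .single h.swap
  | tail _ h ih => exact .tail ih h.swap

theorem transGen_mem_pairs {p q : V × V} (h : Relation.TransGen (DirectlyForces D) p q) :
    q ∈ pairs D := by
  cases h with
  | single h => exact h.2.1
  | tail _ h => exact h.2.1

theorem cls_eq_of_transGen {x y x' y' : V}
    (h : Relation.TransGen (DirectlyForces D) (x, y) (x', y')) : cls D x y = cls D x' y' :=
  Set.ext fun _ => ⟨fun hq => (transGen_symm h).trans hq, fun hq => h.trans hq⟩

theorem cls_swap (x y : V) : cls D y x = inverse (cls D x y) :=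
  Set.ext fun _ => ⟨fun h => transGen_swap h, fun h => transGen_swap h⟩

/-- A semicomplete digraph in which no pair is in the implication class of its inverse. -/
structure IsConsistent (D : Digraph V) : Prop extends IsSemicomplete D where
  cls_ne : ∀ x y, x ≠ y → cls D x y ≠ cls D y x

/-- The implication class of `(x, y)` has more than one element. -/
def Nontriv (D : Digraph V) (x y : V) : Prop :=
  x ≠ y ∧ ∃ x' y', cls D x' y' = cls D x y ∧ (x' ≠ x ∨ y' ≠ y)

/-- Both `xy` and `yx` are arcs. -/
def Double (D : Digraph V) (x y : V) : Prop := D.Adj x y ∧ D.Adj y x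

/-- Exactly one of `xy` and `yx` is an arc, namely `xy`. -/
def Single (D : Digraph V) (x y : V) : Prop := D.Adj x y ∧ ¬ D.Adj y x

/-- The pair `(x, y)` is joined by two arcs or has a nontrivial implication class. -/
def Proper (D : Digraph V) (x y : V) : Prop := Nontriv D x y ∨ Double D x y

theorem Double.symm {x y : V} (h : Double D x y) : Double D y x := ⟨h.2, h.1⟩

theorem cls_flip {x y x' y' : V} (h : cls D x y = cls D x' y') : cls D y x = cls D y' x' := by
  rw [cls_swap x y, cls_swap x' y', h]

theorem Nontriv.symm {x y : V} (h : Nontriv D x y) : Nontriv D y x := by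
  obtain ⟨h, x', y', h1, h2⟩ := h
  exact ⟨h.symm, y', x', cls_flip h1, h2.symm⟩

theorem Nontriv.congr {x y x' y' : V} (h : Nontriv D x y) (e : cls D x' y' = cls D x y)
    (hne : x' ≠ y') : Nontriv D x' y' := by
  obtain ⟨_, a, b, h1, h2⟩ := h
  by_cases hx : x' = x ∧ y' = y
  · obtain ⟨rfl, rfl⟩ := hx
    exact ⟨hne, a, b, h1, h2⟩
  · exact ⟨hne, x, y, e.symm, by
      by_contra! hc
      exact hx ⟨hc.1.symm, hc.2.symm⟩⟩

theorem Proper.symm {x y : V} (h : Proper D x y) : Proper D y x :=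
  Or.imp Nontriv.symm Double.symm h

theorem Proper.congr {x y x' y' : V} (h : Proper D x y) (e : cls D x' y' = cls D x y)
    (hne : x' ≠ y') : Proper D x' y' := by
  by_cases hx : x' = x ∧ y' = y
  · obtain ⟨rfl, rfl⟩ := hx
    exact h
  · exact Or.inl ⟨hne, x, y, e.symm, by
      by_contra! hc
      exact hx ⟨hc.1.symm, hc.2.symm⟩⟩

/-- The basic forcing rule. -/
theorem cls_eq_of_adj {x y z : V} (h1 : D.Adj y x) (h2 : D.Adj x z)
    (h3 : ¬ D.Adj y z) : cls D x y = cls D x z := by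
  by_cases hyz : y = z
  · rw [hyz]
  · exact cls_eq_of_transGen (.single ⟨Or.inr h1, Or.inl h2,
      Or.inr (Or.inl ⟨rfl, hyz, Or.inl ⟨h1, h2, h3⟩⟩)⟩)

/-- A vertex joined by two arcs to both ends of a single arc is not between them. -/
theorem cls_eq_of_double {x y z : V} (h1 : Double D x y) (h2 : Double D x z)
    (h3 : Single D y z) : cls D x y = cls D x z :=
  (cls_eq_of_adj h2.2 h1.1 h3.2).symm

/-- In a path of two single arcs whose ends are joined by two arcs the middle is between. -/
theorem cls_path_right {x y z : V} (h1 : Single D x y) (h2 : Single D y z)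
    (h3 : Double D x z) : cls D y z = cls D x z :=
  cls_flip (cls_eq_of_adj h2.1 h3.2 h1.2)

namespace IsConsistent

theorem mem_cls (hD : IsConsistent D) {x y : V} (h : x ≠ y) : (x, y) ∈ cls D x y :=
  .single (directlyForces_refl (hD.total x y h))

theorem ne_of_adj (hD : IsConsistent D) {x y : V} (h : D.Adj x y) : x ≠ y := by
  rintro rfl
  exact hD.loopless _ h

theorem cls_self (hD : IsConsistent D) (x : V) : cls D x x = ∅ := by
  ext q
  simp only [Set.mem_empty_iff_false, iff_false]
  intro h
  rcases transGen_mem_pairs (transGen_symm h) with h | h <;> exact hD.loopless _ h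

theorem ne_of_cls_eq (hD : IsConsistent D) {x y x' y' : V} (h : cls D x' y' = cls D x y)
    (hne : x ≠ y) : x' ≠ y' := by
  rintro rfl
  have := hD.mem_cls hne
  rw [← h, hD.cls_self] at this
  exact this

theorem transGen_of_cls_eq (hD : IsConsistent D) {x y x' y' : V} (h : cls D x y = cls D x' y')
    (hne : x' ≠ y') : Relation.TransGen (DirectlyForces D) (x, y) (x', y') := by
  have := hD.mem_cls hne
  rwa [← h] at this

theorem proper_ne (hD : IsConsistent D) {x y : V} (h : Proper D x y) : x ≠ y :=
  h.elim (fun h => h.1) (fun h => hD.ne_of_adj h.1)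

theorem single_of_not_adj (hD : IsConsistent D) {x y : V} (h : ¬ D.Adj x y) (hne : x ≠ y) :
    Single D y x := ⟨(hD.total x y hne).resolve_left h, h⟩

theorem trichotomy (hD : IsConsistent D) {x y : V} (h : x ≠ y) :
    Double D x y ∨ Single D x y ∨ Single D y x := by
  have := hD.total x y h
  unfold Double Single
  tauto

/-- No cyclic triangle of single arcs. -/
theorem not_cyclic (hD : IsConsistent D) {x y z : V} (h1 : Single D x y) (h2 : Single D y z)
    (h3 : Single D z x) : False := by
  have e1 := cls_eq_of_adj h1.1 h2.1 h3.2
  have e2 := cls_eq_of_adj h2.1 h3.1 h1.2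
  have e3 := cls_eq_of_adj h3.1 h1.1 h2.2
  exact hD.cls_ne x y (hD.ne_of_adj h1.1) (e3.symm.trans ((cls_flip e2).symm.trans e1.symm))

theorem exists_of_transGen_ne {p q : V × V} (h : Relation.TransGen (DirectlyForces D) p q)
    (hne : q ≠ p) : ∃ r, r ≠ p ∧ DirectlyForces D p r := by
  induction h using Relation.TransGen.head_induction_on with
  | single h => exact ⟨_, hne, h⟩
  | @head a c h _ ih =>
    by_cases hc : c = a
    · subst hc
      exact ih hne
    · exact ⟨_, hc, h⟩

theorem Nontriv.exists_forces (hD : IsConsistent D) {x y : V} (h : Nontriv D x y) :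
    ∃ r, r ≠ (x, y) ∧ DirectlyForces D (x, y) r := by
  obtain ⟨hne, x', y', h1, h2⟩ := h
  refine exists_of_transGen_ne (hD.transGen_of_cls_eq h1.symm (hD.ne_of_cls_eq h1 hne)) ?_
  simp only [ne_eq, Prod.mk.injEq]
  tauto

/-- A single arc with a nontrivial class is in a triangle with another single arc forming a
path with it, the ends of which are joined by two arcs. -/
theorem exists_path (hD : IsConsistent D) {a b : V} (h : Nontriv D a b) (hs : Single D a b) :
    ∃ w, (Single D b w ∧ Double D a w) ∨ (Single D w a ∧ Double D w b) := by
  obtain ⟨⟨c, d⟩, hr, -, -, h⟩ := Nontriv.exists_forces hD h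
  simp only [ne_eq, Prod.mk.injEq] at h hr
  rcases h with ⟨h1, h2⟩ | ⟨h1, h2, h3⟩ | ⟨h1, h2, h3⟩
  · exact absurd ⟨h1.symm, h2.symm⟩ hr
  · subst h1
    rcases h3 with ⟨h3, -, -⟩ | ⟨h3, h4, h5⟩
    · exact absurd h3 hs.2
    · have hbd := hD.single_of_not_adj h5 (Ne.symm h2)
      refine ⟨d, Or.inl ⟨hbd, ?_, h3⟩⟩
      by_contra hc
      exact hD.not_cyclic hs hbd ⟨h3, hc⟩
  · subst h1
    rcases h3 with ⟨h3, h4, h5⟩ | ⟨-, h3, -⟩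
    · have hca := hD.single_of_not_adj h5 h2
      refine ⟨c, Or.inr ⟨hca, ?_, h4⟩⟩
      by_contra hc
      exact hD.not_cyclic hs ⟨h4, hc⟩ hca
    · exact absurd h3 hs.2

end IsConsistent

/-! ### The triangle lemma -/

namespace IsConsistent

/-- The ends of a chain `a`, `b`, `w`, `c` of single arcs, with double arcs between `a`, `w` and
`b`, `c`, are in the class of the chain if they are joined by a nontrivial single arc. -/
theorem cls_eq_of_chain (hD : IsConsistent D) {a b c w : V} (sab : Single D a b)
    (sbw : Single D b w) (swc : Single D w c) (haw : Double D a w) (hbc : Double D b c)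
    (sac : Single D a c) (hac : Nontriv D a c) : cls D b c = cls D a c := by
  obtain ⟨v, ⟨hcv, hav⟩ | ⟨hva, hvc⟩⟩ := hD.exists_path hac sac
  · have nvw : v ≠ w := by grind [Single, Double]
    rcases hD.trichotomy nvw with hvw | hvw | hvw
    · grind -ext [→ cls_eq_of_adj, cls_swap, Single, Double]
    · exact (hD.not_cyclic swc hcv hvw).elim
    · have := hD.cls_ne a b (hD.ne_of_adj sab.1)
      grind -ext [→ cls_eq_of_adj, cls_swap, Single, Double]
  · have nvb : v ≠ b := by grind [Single, Double]
    rcases hD.trichotomy nvb with hvb | hvb | hvb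
    · grind -ext [→ cls_eq_of_adj, cls_swap, Single, Double]
    · grind -ext [→ cls_eq_of_adj, cls_swap, Single, Double]
    · exact (hD.not_cyclic hva sab hvb).elim

/-- The case of the triangle lemma in which `a` dominates the other vertices. -/
theorem cls_eq_of_dominates (hD : IsConsistent D) {a b c d : V}
    (hcb : D.Adj c b) (hbd : D.Adj b d) (hdc : Single D d c)
    (sab : Single D a b) (sac : Single D a c) (had : D.Adj a d)
    (hab : Nontriv D a b) (hac : Nontriv D a c)
    (h1 : cls D b c ≠ cls D a c) (h2 : cls D b c ≠ cls D b a) : cls D a d = cls D a c := by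
  have hbc_bd : cls D b c = cls D b d := cls_eq_of_adj hcb hbd hdc.2
  have nbc : b ≠ c := (hD.ne_of_adj hcb).symm
  have nbd : b ≠ d := hD.ne_of_adj hbd
  -- The third vertex `w` exists because `(a, b)` is nontrivial; the arcs from `w` to `c` and `d`
  -- either force the claim or contradict a hypothesis.
  obtain ⟨w, ⟨hbw, haw⟩ | ⟨hwa, hwb⟩⟩ := hD.exists_path hab sab
  · have nwc : w ≠ c := by grind [Single, Double]
    rcases hD.trichotomy nwc with hwc | hwc | hwc
    · rcases hD.trichotomy nbc with hbc | hbc | hbc <;>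
        grind -ext [→ cls_eq_of_adj, cls_swap, Single, Double]
    · have hbc : Double D b c := by
        refine ⟨?_, hcb⟩
        by_contra h
        exact hD.not_cyclic ⟨hcb, h⟩ hbw hwc
      exact absurd (hD.cls_eq_of_chain sab hbw hwc haw hbc sac hac) h1
    · have nwd : w ≠ d := by grind [Single, Double]
      rcases hD.trichotomy nwd with hwd | hwd | hwd
      · rcases hD.trichotomy nbd with hbd' | hbd' | hbd' <;>
          grind -ext [→ cls_eq_of_adj, cls_swap, Single, Double]
      · exact (hD.not_cyclic hwd hdc hwc).elim
      · grind -ext [→ cls_eq_of_adj, cls_swap, Single, Double]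
  · have nwc : w ≠ c := by grind [Single, Double]
    have nwd : w ≠ d := by grind [Single, Double]
    rcases hD.trichotomy nwc with hwc | hwc | hwc
    · rcases hD.trichotomy nwd with hwd | hwd | hwd <;>
        rcases hD.trichotomy nbd with hbd' | hbd' | hbd' <;>
        grind -ext [→ cls_eq_of_adj, cls_swap, Single, Double]
    · rcases hD.trichotomy nbc with hbc | hbc | hbc <;>
      grind -ext [→ cls_eq_of_adj, cls_swap, Single, Double]
    · exact (hD.not_cyclic hwa sac hwc).elim

/-- A variant of `cls_eq_of_dominates` with the assumptions on `(a, c)` made on `(a, d)`. -/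
theorem cls_eq_of_dominates' (hD : IsConsistent D) {a b c d : V}
    (hcb : D.Adj c b) (hbd : D.Adj b d) (hdc : Single D d c)
    (sab : Single D a b) (sac : Single D a c) (had : D.Adj a d)
    (hab : Nontriv D a b) (hac : Proper D a d)
    (h1 : cls D b d ≠ cls D a d) (h2 : cls D b c ≠ cls D b a) : cls D a d = cls D a c := by
  have hbc_bd : cls D b c = cls D b d := cls_eq_of_adj hcb hbd hdc.2
  have nbc : b ≠ c := (hD.ne_of_adj hcb).symm
  have nbd : b ≠ d := hD.ne_of_adj hbd
  have nad : a ≠ d := hD.ne_of_adj had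
  by_contra hgoal
  obtain ⟨w, hw⟩ := hD.exists_path hab sab
  by_cases had' : Double D a d
  · rcases hw with ⟨hbw, haw⟩ | ⟨hwa, hwb⟩
    · have nwc : w ≠ c := by grind [Single, Double]
      rcases hD.trichotomy nwc with hwc | hwc | hwc <;>
      rcases hD.trichotomy nbc with hbc | hbc | hbc <;>
      rcases hD.trichotomy nbd with hbd' | hbd' | hbd' <;>
      grind -ext [→ cls_eq_of_adj, cls_swap, Single, Double]
    · have nwc : w ≠ c := by grind [Single, Double]
      rcases hD.trichotomy nwc with hwc | hwc | hwc <;>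
      rcases hD.trichotomy nbc with hbc | hbc | hbc <;>
      rcases hD.trichotomy nbd with hbd' | hbd' | hbd' <;>
      grind -ext [→ cls_eq_of_adj, cls_swap, Single, Double]
  · have sad : Single D a d := ⟨had, fun h => had' ⟨had, h⟩⟩
    have nad' := hac.resolve_right had'
    -- Assuming the claim fails, the witness for `(a, b)` excludes every other configuration; the
    -- one that remains is refuted by a witness for `(a, d)`.
    have hbs : Double D b c ∧ Single D b d := by
      rcases hw with ⟨hbw, haw⟩ | ⟨hwa, hwb⟩
      · have nwc : w ≠ c := by grind [Single, Double]
        have nwd : w ≠ d := by grind [Single, Double]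
        have := hD.cls_eq_of_chain (c := d) sab hbw
        rcases hD.trichotomy nwc with hwc | hwc | hwc <;>
        rcases hD.trichotomy nbc with hbc | hbc | hbc <;>
        rcases hD.trichotomy nbd with hbd' | hbd' | hbd' <;>
        rcases hD.trichotomy nwd with hwd | hwd | hwd <;>
        grind -ext [→ cls_eq_of_adj, cls_swap, Single, Double, not_cyclic]
      · have nwc : w ≠ c := by grind [Single, Double]
        have nwd : w ≠ d := by grind [Single, Double]
        rcases hD.trichotomy nwc with hwc | hwc | hwc <;>
        rcases hD.trichotomy nbc with hbc | hbc | hbc <;>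
        rcases hD.trichotomy nbd with hbd' | hbd' | hbd' <;>
        rcases hD.trichotomy nwd with hwd | hwd | hwd <;>
        grind -ext [→ cls_eq_of_adj, cls_swap, Single, Double, not_cyclic]
    obtain ⟨hbc, sbd⟩ := hbs
    obtain ⟨v, hv⟩ := hD.exists_path nad' sad
    have nvb : v ≠ b := by grind [Single, Double]
    have nvc : v ≠ c := by grind [Single, Double]
    rcases hD.trichotomy nvb with hvb | hvb | hvb <;>
    rcases hD.trichotomy nvc with hvc | hvc | hvc <;>
    rcases hv with ⟨hv1, hv2⟩ | ⟨hv1, hv2⟩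
    all_goals grind -ext [→ cls_eq_of_adj, cls_swap, Single, Double, not_cyclic]

end IsConsistent

/-- The digraph with all arcs reversed. -/
def rev (D : Digraph V) : Digraph V where
  Adj x y := D.Adj y x

/-- Reversal only exchanges the alternatives within each clause of `Γ`. Classes are therefore
unchanged, and dual cases come for free. -/
theorem directlyForces_rev : DirectlyForces (rev D) = DirectlyForces D := by
  funext p q
  simp only [DirectlyForces, pairs, rev, Set.mem_ofPred_eq, eq_iff_iff]
  tauto

theorem cls_rev (x y : V) : cls (rev D) x y = cls D x y := by
  simp only [cls, directlyForces_rev]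

theorem nontriv_rev {x y : V} : Nontriv (rev D) x y ↔ Nontriv D x y := by
  simp only [Nontriv, cls_rev]

theorem double_rev {x y : V} : Double (rev D) x y ↔ Double D x y := and_comm

theorem proper_rev {x y : V} : Proper (rev D) x y ↔ Proper D x y := by
  simp only [Proper, nontriv_rev, double_rev]

namespace IsConsistent

theorem rev (hD : IsConsistent D) : IsConsistent (rev D) where
  loopless := hD.loopless
  total x y h := hD.total y x h.symm
  cls_ne x y h := by
    simp only [cls_rev]
    exact hD.cls_ne x y h

/-- If `c → a → d`, the claim is a direct forcing. Otherwise `a` dominates the other three vertices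
or is dominated by them. Reversal exchanges `c` and `d`, which is why the second case needs the
variant with its assumption on `(a, d)`. -/
theorem cls_eq_of_adj_triangle (hD : IsConsistent D) {a b c d : V}
    (hcb : D.Adj c b) (hbd : D.Adj b d) (hcd : c ≠ d) (hdc : ¬ D.Adj c d)
    (hab : Proper D a b) (hac : Proper D a c)
    (h1 : cls D b c ≠ cls D a c) (h2 : cls D b c ≠ cls D b a) : cls D a d = cls D a c := by
  have hbc_bd : cls D b c = cls D b d := cls_eq_of_adj hcb hbd hdc
  have had : a ≠ d := by
    rintro rfl
    exact h2 hbc_bd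
  have sdc : Single D d c := hD.single_of_not_adj hdc hcd
  have nab := hD.proper_ne hab
  have nac := hD.proper_ne hac
  by_cases hdirect : D.Adj c a ∧ D.Adj a d
  · exact (cls_eq_of_adj hdirect.1 hdirect.2 hdc).symm
  have hns : (Single D a b ∧ Single D a c ∧ D.Adj a d) ∨
      (Single D b a ∧ Single D d a ∧ D.Adj c a) := by
    rcases hD.trichotomy nab with h | h | h <;> rcases hD.trichotomy nac with h' | h' | h' <;>
    rcases hD.trichotomy had with h'' | h'' | h'' <;>
      grind -ext [→ cls_eq_of_adj, cls_swap, Single, Double]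
  rcases hns with ⟨sab, sac, adj_ad⟩ | ⟨sba, sda, adj_ca⟩
  · exact hD.cls_eq_of_dominates hcb hbd sdc sab sac adj_ad
      (hab.resolve_right fun h => sab.2 h.2) (hac.resolve_right fun h => sac.2 h.2) h1 h2
  · have := hD.rev.cls_eq_of_dominates' (a := a) (b := b) (c := d) (d := c) hbd hcb sdc sba sda
      adj_ca (nontriv_rev.2 (hab.resolve_right fun h => sba.2 h.1)) (proper_rev.2 hac)
    simp only [cls_rev] at this
    exact (this h1 (hbc_bd ▸ h2)).symm

theorem triangle_step (hD : IsConsistent D) {a b c d : V}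
    (h : DirectlyForces D (b, c) (b, d)) (hab : Proper D a b) (hac : Proper D a c)
    (h1 : cls D b c ≠ cls D a c) (h2 : cls D b c ≠ cls D b a) : cls D a d = cls D a c := by
  obtain ⟨-, -, h⟩ := h
  simp only [true_and, ne_eq, not_true_eq_false, false_and, and_false, or_false] at h
  rcases h with rfl | ⟨hcd, ⟨h3, h4, h5⟩ | ⟨h3, h4, h5⟩⟩
  · rfl
  · exact hD.cls_eq_of_adj_triangle h3 h4 hcd h5 hab hac h1 h2
  · have := hD.rev.cls_eq_of_adj_triangle (a := a) (b := b) (c := c) (d := d) h4 h3 hcd h5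
      (proper_rev.2 hab) (proper_rev.2 hac)
    simp only [cls_rev] at this
    exact this h1 h2

/-- The triangle lemma. -/
theorem triangle (hD : IsConsistent D) {a b c : V} (hab : Proper D a b) (hac : Proper D a c)
    (h1 : cls D b c ≠ cls D a c) (h2 : cls D b c ≠ cls D b a) {b' c' : V} (hbc : b ≠ c)
    (h : cls D b' c' = cls D b c) : cls D a b' = cls D a b ∧ cls D a c' = cls D a c := by
  have key : ∀ q : V × V, Relation.TransGen (DirectlyForces D) (b, c) q →
      cls D a q.1 = cls D a b ∧ cls D a q.2 = cls D a c := by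
    -- Induction along a chain of forcings: the hypotheses of `triangle_step` depend only on the
    -- three classes, so they survive each move. Moves of the first coordinate are handled by
    -- swapping.
    have step : ∀ p q : V × V, cls D p.1 p.2 = cls D b c → cls D a p.1 = cls D a b →
        cls D a p.2 = cls D a c → DirectlyForces D p q →
        cls D a q.1 = cls D a b ∧ cls D a q.2 = cls D a c := by
      rintro ⟨x, y⟩ ⟨z, w⟩ e1 e2 e3 hf
      dsimp only at e1 e2 e3 ⊢
      have hax : Proper D a x := hab.congr e2 (hD.ne_of_cls_eq e2 (hD.proper_ne hab))
      have hay : Proper D a y := hac.congr e3 (hD.ne_of_cls_eq e3 (hD.proper_ne hac))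
      have g1 : cls D x y ≠ cls D a y := by rw [e1, e3]; exact h1
      have g2 : cls D x y ≠ cls D x a := by rw [e1, cls_flip e2]; exact h2
      obtain hz | hz : x = z ∨ y = w := by
        rcases hf.2.2 with h | h | h
        · exact Or.inl h.1
        · exact Or.inl h.1
        · exact Or.inr h.1
      · subst hz
        exact ⟨e2, (hD.triangle_step hf hax hay g1 g2).trans e3⟩
      · subst hz
        refine ⟨(hD.triangle_step hf.swap hay hax ?_ ?_).trans e2, e3⟩
        · exact fun h => g2 (cls_flip h)
        · exact fun h => g1 (cls_flip h)
    intro q hq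
    induction hq with
    | single hf => exact step _ _ rfl rfl rfl hf
    | tail hq hf ih => exact step _ _ (cls_eq_of_transGen hq).symm ih.1 ih.2 hf
  exact key (b', c') (hD.transGen_of_cls_eq h.symm (hD.ne_of_cls_eq h hbc))

end IsConsistent

/-! ### Improper pairs -/

/-- The pair `(x, z)` is joined by the single arc `xz` and has a trivial implication class. -/
def Improper (D : Digraph V) (x z : V) : Prop := Single D x z ∧ ¬ Nontriv D x z

/-- Otherwise `w → x → z` without `w → z` would force `(x, z)` together with `(x, w)`, making the
class nontrivial. -/
theorem Improper.adj_left {x z w : V} (h : Improper D x z) (hw : D.Adj w x) : D.Adj w z := by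
  by_contra hc
  have hxz : x ≠ z := by
    rintro rfl
    exact hc hw
  refine h.2 ⟨hxz, x, w, cls_eq_of_adj hw h.1.1 hc, Or.inr ?_⟩
  rintro rfl
  exact h.1.2 hw

theorem Improper.adj_right {x z w : V} (h : Improper D x z) (hw : D.Adj z w) : D.Adj x w := by
  by_contra hc
  have hxz : x ≠ z := by
    rintro rfl
    exact hc hw
  refine h.2 (Nontriv.symm ⟨hxz.symm, z, w, (cls_eq_of_adj h.1.1 hw hc).symm, Or.inr ?_⟩)
  rintro rfl
  exact h.1.2 hw

namespace IsConsistent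

theorem improper_or (hD : IsConsistent D) {x z : V} (hne : x ≠ z) (h : ¬ Proper D x z) :
    Improper D x z ∨ Improper D z x := by
  have h1 : ¬ Nontriv D x z := fun h' => h (Or.inl h')
  rcases hD.trichotomy hne with hs | hs | hs
  · exact absurd (Or.inr hs) h
  · exact Or.inl ⟨hs, h1⟩
  · exact Or.inr ⟨hs, fun h' => h1 h'.symm⟩

/-- The possible positions of a vertex strictly between the ends of an improper pair. -/
theorem improper_cases (hD : IsConsistent D) {x y z : V} (h : Improper D x z)
    (hxy : Proper D x y) (hyz : Proper D y z) (hne : cls D y x ≠ cls D y z) :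
    (Double D x y ∧ Single D y z ∧ ∃ w, Single D x w ∧ Single D w y ∧ Double D w z) ∨
    (Single D x y ∧ Double D y z ∧ ∃ w, Single D y w ∧ Single D w z ∧ Double D x w) ∨
    (Single D x y ∧ Single D y z) := by
  have nxy := hD.proper_ne hxy
  have nyz := hD.proper_ne hyz
  have hxz := h.1
  have hl := fun w => h.adj_left (w := w)
  have hr := fun w => h.adj_right (w := w)
  rcases hD.trichotomy nyz with h2 | h2 | h2
  · rcases hD.trichotomy nxy with h1 | h1 | h1
    · grind -ext [→ cls_eq_of_adj, cls_swap, Single, Double]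
    · refine Or.inr (Or.inl ⟨h1, h2, ?_⟩)
      obtain ⟨w, ⟨hw1, hw2⟩ | ⟨hw1, hw2⟩⟩ :=
        hD.exists_path (hxy.resolve_right fun h => h1.2 h.2) h1
      · refine ⟨w, hw1, ?_, hw2⟩
        have := hl w hw2.2
        grind -ext [→ cls_eq_of_adj, cls_swap, Single, Double]
      · have := hl w hw1.1
        grind -ext [→ cls_eq_of_adj, cls_swap, Single, Double]
    · grind -ext [Single, Double]
  · rcases hD.trichotomy nxy with h1 | h1 | h1
    · refine Or.inl ⟨h1, h2, ?_⟩
      obtain ⟨w, ⟨hw1, hw2⟩ | ⟨hw1, hw2⟩⟩ :=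
        hD.exists_path (hyz.resolve_right fun h => h2.2 h.2) h2
      · have := hr w hw1.1
        grind -ext [→ cls_eq_of_adj, cls_swap, Single, Double]
      · refine ⟨w, ?_, hw1, hw2⟩
        have := hr w hw2.2
        grind -ext [→ cls_eq_of_adj, cls_swap, Single, Double]
    · exact Or.inr (Or.inr ⟨h1, h2⟩)
    · obtain ⟨w, ⟨hw1, hw2⟩ | ⟨hw1, hw2⟩⟩ :=
        hD.exists_path (hyz.resolve_right fun h => h2.2 h.2) h2
      · have := hr w hw1.1
        grind -ext [→ cls_eq_of_adj, cls_swap, Single, Double]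
      · have := hr w hw2.2
        grind -ext [→ cls_eq_of_adj, cls_swap, Single, Double, not_cyclic]
  · rcases hD.trichotomy nxy with h1 | h1 | h1
    · grind -ext [Single, Double]
    · obtain ⟨w, ⟨hw1, hw2⟩ | ⟨hw1, hw2⟩⟩ :=
        hD.exists_path (hxy.resolve_right fun h => h1.2 h.2) h1
      · have := hl w hw2.2
        grind -ext [→ cls_eq_of_adj, cls_swap, Single, Double, not_cyclic]
      · have := hl w hw1.1
        grind -ext [→ cls_eq_of_adj, cls_swap, Single, Double]
    · exact (hD.not_cyclic h1 hxz h2).elim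

theorem cls_eq_of_improper_aux (hD : IsConsistent D) {x y z : V} (h : Improper D x z)
    (hxy : Proper D x y) (hyz : Proper D y z) (hne : cls D y x ≠ cls D y z) :
    cls D x y = cls D y z := by
  have hxz := h.1
  have hl := fun w => h.adj_left (w := w)
  have hr := fun w => h.adj_right (w := w)
  rcases hD.improper_cases h hxy hyz hne with
    ⟨h1, h2, w, hw⟩ | ⟨h1, h2, w, hw⟩ | ⟨h1, h2⟩
  -- The chain is `(x, y)`, `(w, y)`, `(w, z)`, `(y, z)`; the next case is its mirror image.
  · grind -ext [→ cls_eq_of_adj, cls_swap, Single, Double]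
  · grind -ext [→ cls_eq_of_adj, cls_swap, Single, Double]
  -- With two single arcs both pairs are nontrivial; their witnesses `v` and `w` are compared.
  obtain ⟨v, hv⟩ := hD.exists_path (hxy.resolve_right fun h => h1.2 h.2) h1
  obtain ⟨w, hw⟩ := hD.exists_path (hyz.resolve_right fun h => h2.2 h.2) h2
  have nvw : v ≠ w := by grind -ext [Single, Double]
  rcases hv with ⟨hv1, hv2⟩ | ⟨hv1, hv2⟩ <;> rcases hw with ⟨hw1, hw2⟩ | ⟨hw1, hw2⟩ <;>
  rcases hD.trichotomy nvw with hvw | hvw | hvw <;>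
  grind -ext [→ cls_eq_of_adj, cls_swap, Single, Double, not_cyclic]

theorem cls_eq_of_improper (hD : IsConsistent D) {x y z : V} (hne' : x ≠ z) (h : ¬ Proper D x z)
    (hxy : Proper D x y) (hyz : Proper D y z) (hne : cls D y x ≠ cls D y z) :
    cls D x y = cls D y z := by
  rcases hD.improper_or hne' h with h | h
  · exact hD.cls_eq_of_improper_aux h hxy hyz hne
  · exact (cls_flip (hD.cls_eq_of_improper_aux h hyz.symm hxy.symm hne.symm)).symm

end IsConsistent

/-! ### Partial and closed orientations -/

/-- `T` is an asymmetric union of implication classes of proper pairs. -/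
structure IsPartialOrientation (D : Digraph V) (T : V → V → Prop) : Prop where
  proper : ∀ {x y}, T x y → Proper D x y
  congr : ∀ {x y x' y'}, T x y → cls D x' y' = cls D x y → T x' y'
  asymm : ∀ {x y}, T x y → ¬ T y x

/-- A partial orientation that is transitive as far as proper pairs are concerned. -/
structure IsClosedOrientation (D : Digraph V) (T : V → V → Prop) : Prop
    extends IsPartialOrientation D T where
  trans : ∀ {x y z}, T x y → T y z → Proper D x z → T x z

namespace IsPartialOrientation

variable {T : V → V → Prop}

theorem ne_of_path (hT : IsPartialOrientation D T) {x y z : V} (h1 : T x y) (h2 : T y z) :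
    x ≠ z := by
  rintro rfl
  exact hT.asymm h1 h2

theorem cls_ne_left (hT : IsPartialOrientation D T) {x y z : V} (h1 : T x y) (h2 : T y z) :
    cls D y x ≠ cls D y z := fun h => hT.asymm h1 (hT.congr h2 h)

theorem cls_ne_right (hT : IsPartialOrientation D T) {x y z : V} (h1 : T x y) (h2 : T y z) :
    cls D x y ≠ cls D z y := fun h => hT.cls_ne_left h1 h2 (cls_flip h)

theorem cls_eq_of_not_proper (hT : IsPartialOrientation D T) (hD : IsConsistent D) {x y z : V}
    (h1 : T x y) (h2 : T y z) (h : ¬ Proper D x z) : cls D x y = cls D y z :=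
  hD.cls_eq_of_improper (hT.ne_of_path h1 h2) h (hT.proper h1) (hT.proper h2)
    (hT.cls_ne_left h1 h2)

theorem not_four_cycle_aux (hT : IsPartialOrientation D T) (hD : IsConsistent D)
    {x₀ x₁ x₂ x₃ : V} (h0 : T x₀ x₁) (h1 : T x₁ x₂) (h2 : T x₂ x₃) (h3 : T x₃ x₀)
    (g0 : Improper D x₀ x₂) (g1 : Improper D x₁ x₃) : False := by
  have p0 := hT.proper h0
  have p1 := hT.proper h1
  have p2 := hT.proper h2
  have p3 := hT.proper h3
  have c0 := hD.improper_cases g0 p0 p1 (hT.cls_ne_left h0 h1)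
  have c1 := hD.improper_cases g1 p1 p2 (hT.cls_ne_left h1 h2)
  have c2 := hD.improper_cases g0 p3.symm p2.symm (hT.cls_ne_left h2 h3).symm
  have c3 := hD.improper_cases g1 p0.symm p3.symm (hT.cls_ne_left h3 h0).symm
  -- The four position analyses, two for each diagonal, are compatible only in this way. The vertex
  -- `w` between `x₀` and `x₁` then gives `(x₂, x₁)` the class of `(x₂, x₃)`, against asymmetry.
  have hs : Double D x₀ x₁ ∧ Single D x₁ x₂ ∧ Double D x₂ x₃ := by
    grind -ext [Single, Double]
  obtain ⟨s1, s2, s3⟩ := hs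
  rcases c0 with ⟨-, -, w, w1, w2, w3⟩ | ⟨h, -, -⟩ | ⟨h, -⟩
  · have hw := g1.adj_left w2.1
    have hne := hT.cls_ne_left h1 h2
    have hw' : ¬ D.Adj x₃ w := fun h => w2.2 (g1.adj_right h)
    have e1 := cls_eq_of_double w3.symm s3 ⟨hw, hw'⟩
    have e2 := cls_path_right w2 s2 w3
    exact hne ((cls_flip e2).trans e1)
  · exact h.2 s1.2
  · exact h.2 s1.2

/-- Rotating the cycle brings the two diagonals into the directions treated above. -/
theorem not_four_cycle (hT : IsPartialOrientation D T) (hD : IsConsistent D)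
    {x₀ x₁ x₂ x₃ : V} (h0 : T x₀ x₁) (h1 : T x₁ x₂) (h2 : T x₂ x₃) (h3 : T x₃ x₀)
    (g0 : ¬ Proper D x₀ x₂) (g1 : ¬ Proper D x₁ x₃) : False := by
  rcases hD.improper_or (hT.ne_of_path h0 h1) g0 with g0 | g0 <;>
  rcases hD.improper_or (hT.ne_of_path h1 h2) g1 with g1 | g1
  · exact hT.not_four_cycle_aux hD h0 h1 h2 h3 g0 g1
  · exact hT.not_four_cycle_aux hD h3 h0 h1 h2 g1 g0
  · exact hT.not_four_cycle_aux hD h1 h2 h3 h0 g1 g0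
  · exact hT.not_four_cycle_aux hD h2 h3 h0 h1 g0 g1

/-- Adding an undecided class. -/
theorem union_cls (hT : IsPartialOrientation D T) (hD : IsConsistent D) {u v : V}
    (huv : Proper D u v) (h2 : ¬ T v u) :
    IsPartialOrientation D (fun x y => T x y ∨ cls D x y = cls D u v) where
  proper h := h.elim hT.proper
    fun h => huv.congr h (hD.ne_of_cls_eq h (hD.proper_ne huv))
  congr h e := h.imp (fun h => hT.congr h e) (fun h => e.trans h)
  asymm {x y} h h' := by
    rcases h with h | h <;> rcases h' with h' | h'
    · exact hT.asymm h h'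
    · exact h2 (hT.congr h (cls_flip h').symm)
    · exact h2 (hT.congr h' (cls_flip h).symm)
    · exact hD.cls_ne u v (hD.proper_ne huv) (h.symm.trans (cls_flip h'))

end IsPartialOrientation

/-! ### Extending a closed orientation by one pair -/

/-- The extension of `T` by the pair `(u, v)` and all that it implies. -/
def extend (D : Digraph V) (T : V → V → Prop) (u v x y : V) : Prop :=
  T x y ∨ (Proper D x y ∧
    ∃ s t, cls D s t = cls D x y ∧ (s = u ∨ T s u) ∧ (v = t ∨ T v t))

namespace IsClosedOrientation

variable {T : V → V → Prop} {u v : V}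

/-- The path `v, t, s, u` in `T` would shorten to `T v u`, unless both of its shortcuts are
improper; then adding the class of `(u, v)` produces a forbidden four-cycle. -/
theorem not_back (hT : IsClosedOrientation D T) (hD : IsConsistent D) (huv : Proper D u v)
    (h2 : ¬ T v u) {s t : V} (hs : s = u ∨ T s u) (ht : v = t ∨ T v t) :
    ¬ T t s := by
  intro hts
  rcases hs with rfl | hs <;> rcases ht with rfl | ht
  · exact h2 hts
  · exact h2 (hT.trans ht hts huv.symm)
  · exact h2 (hT.trans hts hs huv.symm)
  · by_cases p1 : Proper D v s
    · exact h2 (hT.trans (hT.trans ht hts p1) hs huv.symm)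
    by_cases p2 : Proper D t u
    · exact h2 (hT.trans ht (hT.trans hts hs p2) huv.symm)
    exact (hT.union_cls hD huv h2).not_four_cycle hD (Or.inl ht) (Or.inl hts) (Or.inl hs)
      (Or.inr rfl) p1 p2

/-- The triangle lemma replaces `s` by `u` and then `t` by `v` without leaving the class: a failure
would carry `T` to a pair excluded by `not_back`. Applied to both of two opposite implied pairs,
this would identify `(u, v)` with `(v, u)`. -/
theorem cls_eq_of_opposite (hT : IsClosedOrientation D T) (hD : IsConsistent D)
    (huv : Proper D u v) (h1 : ¬ T u v) (h2 : ¬ T v u) {s t s' t' : V}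
    (hs : s = u ∨ T s u) (ht : v = t ∨ T v t) (hs' : s' = u ∨ T s' u) (ht' : v = t' ∨ T v t')
    (hp : Proper D s t) (h : cls D t' s' = cls D s t) : cls D s t = cls D u v := by
  have hU := hT.union_cls hD huv h2
  have hut : Proper D u t := by
    rcases ht with rfl | ht
    · exact huv
    · by_contra hc
      exact h1 (hT.congr ht (hU.cls_eq_of_not_proper hD (Or.inr rfl) (Or.inl ht) hc))
  have nb := fun h => hT.not_back hD huv h2 hs' ht' h
  have e1 : cls D s t = cls D u t := by
    rcases hs with rfl | hs
    · rfl
    · by_contra hc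
      have hne : cls D s t ≠ cls D s u := fun e => nb (hT.congr hs (h.trans e))
      have := (hD.triangle (hT.proper hs).symm hut hc hne (hD.proper_ne hp) h).1
      exact hT.not_back hD huv h2 (Or.inl rfl) ht' (hT.congr hs (cls_flip this))
  rcases ht with rfl | ht
  · exact e1
  · by_contra hc
    rw [e1] at hc h
    have hne : cls D u t ≠ cls D v t := fun e => nb (hT.congr ht (h.trans e))
    have := (hD.triangle huv.symm (hT.proper ht) hne hc (hD.proper_ne hut) h).2
    exact hT.not_back hD huv h2 hs' (Or.inl rfl) (hT.congr ht this)

theorem isPartialOrientation_extend (hT : IsClosedOrientation D T) (hD : IsConsistent D)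
    (huv : Proper D u v) (h1 : ¬ T u v) (h2 : ¬ T v u) :
    IsPartialOrientation D (extend D T u v) where
  proper h := h.elim hT.proper fun h => h.1
  congr {x y x' y'} h e := by
    rcases h with h | ⟨hp, s, t, h, hs, ht⟩
    · exact Or.inl (hT.congr h e)
    · exact Or.inr ⟨hp.congr e (hD.ne_of_cls_eq e (hD.proper_ne hp)), s, t, h.trans e.symm, hs, ht⟩
  asymm {x y} h h' := by
    rcases h with h | ⟨hp, s, t, h, hs, ht⟩ <;> rcases h' with h' | ⟨hp', s', t', h', hs', ht'⟩
    · exact hT.asymm h h'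
    · exact hT.not_back hD huv h2 hs' ht' (hT.congr h (cls_flip h'))
    · exact hT.not_back hD huv h2 hs ht (hT.congr h' (cls_flip h))
    · have hst := hp.congr h (hD.ne_of_cls_eq h (hD.proper_ne hp))
      have hst' := hp'.congr h' (hD.ne_of_cls_eq h' (hD.proper_ne hp'))
      have e : cls D t' s' = cls D s t := (cls_flip h').trans h.symm
      have e1 := hT.cls_eq_of_opposite hD huv h1 h2 hs ht hs' ht' hst e
      have e2 := hT.cls_eq_of_opposite hD huv h1 h2 hs' ht' hs ht hst' (cls_flip e).symm
      exact hD.cls_ne u v (hD.proper_ne huv) (e1.symm.trans (e.symm.trans (cls_flip e2)))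

/-- Unless `(x, z)` shares the class of one of the two given pairs, the triangle lemma transports
the configuration to the representatives `(s, t)` of the new pairs, where the paths to `u` and from
`v` can be composed. -/
theorem isClosedOrientation_extend (hT : IsClosedOrientation D T) (hD : IsConsistent D)
    (huv : Proper D u v) (h1 : ¬ T u v) (h2 : ¬ T v u) :
    IsClosedOrientation D (extend D T u v) where
  toIsPartialOrientation := hT.isPartialOrientation_extend hD huv h1 h2
  trans {x y z} hxy hyz hxz := by
    have hE := hT.isPartialOrientation_extend hD huv h1 h2
    have pxy := hE.proper hxy
    have pyz := hE.proper hyz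
    have nxy := hD.proper_ne pxy
    have nyz := hD.proper_ne pyz
    by_cases k1 : cls D x z = cls D x y
    · exact hE.congr hxy k1
    by_cases k2 : cls D x z = cls D y z
    · exact hE.congr hyz k2
    rcases id hxy with h | ⟨-, s, t, h, hs, ht⟩
    · rcases id hyz with h' | ⟨-, s, t, h', hs, ht⟩
      · exact Or.inl (hT.trans h h' hxz)
      · obtain ⟨e1, e2⟩ := hD.triangle pxy hxz (Ne.symm k2) (hE.cls_ne_left hxy hyz).symm nyz h'
        refine Or.inr ⟨hxz, x, t, e2, ?_, ht⟩
        have hxs : T x s := hT.congr h e1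
        rcases hs with rfl | hs
        · exact Or.inr hxs
        · right
          by_contra hc
          have hc' : ¬ Proper D x u := fun p => hc (hT.trans hxs hs p)
          have e3 := hT.cls_eq_of_not_proper hD hxs hs hc'
          have hst := hE.congr hyz h'
          have pxt : Proper D x t := hxz.congr e2 (hD.ne_of_cls_eq e2 (hD.proper_ne hxz))
          have := (hD.triangle pxt.symm (hE.proper hst).symm
            (hE.cls_ne_right (Or.inl hxs) hst) (by rw [e1, e2]; exact Ne.symm k1)
            (hD.proper_ne (hT.proper hxs)) e3.symm).1
          exact k2 (e2.symm.trans ((cls_flip this).symm.trans h'))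
    · obtain ⟨e1, e2⟩ := hD.triangle hxz.symm pyz.symm (hE.cls_ne_right hxy hyz)
        (Ne.symm k1) nxy h
      have e1 := cls_flip e1
      have e2 := cls_flip e2
      have hst := hE.congr hxy h
      have htz := hE.congr hyz e2
      have psz : Proper D s z := hxz.congr e1 (hD.ne_of_cls_eq e1 (hD.proper_ne hxz))
      have tri := fun {b' c' : V} => hD.triangle (b' := b') (c' := c') (hE.proper hst) psz
        (by rw [e1, e2]; exact Ne.symm k2) (hE.cls_ne_left hst htz).symm
        (hD.proper_ne (hE.proper htz))
      rcases id hyz with h' | ⟨-, s', t', h', hs', ht'⟩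
      · refine Or.inr ⟨hxz, s, z, e1, hs, ?_⟩
        have htz' : T t z := hT.congr h' e2
        rcases ht with rfl | ht
        · exact Or.inr htz'
        · right
          by_contra hc
          have hc' : ¬ Proper D v z := fun p => hc (hT.trans ht htz' p)
          have := (tri (hT.cls_eq_of_not_proper hD ht htz' hc')).2
          exact k1 (e1.symm.trans (this.symm.trans h))
      · exact Or.inr ⟨hxz, s, t', ((tri (h'.trans e2.symm)).2).trans e1, hs, ht'⟩

/-- A closed orientation extends to one that decides a given proper pair as wanted. -/
theorem exists_extension (hT : IsClosedOrientation D T) (hD : IsConsistent D)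
    (huv : Proper D u v) (h2 : ¬ T v u) :
    ∃ T', IsClosedOrientation D T' ∧ (∀ x y, T x y → T' x y) ∧ T' u v := by
  by_cases h1 : T u v
  · exact ⟨T, hT, fun _ _ h => h, h1⟩
  · exact ⟨_, hT.isClosedOrientation_extend hD huv h1 h2, fun _ _ h => Or.inl h,
      Or.inr ⟨huv, u, v, rfl, Or.inl rfl, Or.inl rfl⟩⟩

/-- A closed orientation extends to one that decides all proper pairs. -/
theorem exists_total [Finite V] (hT : IsClosedOrientation D T) (hD : IsConsistent D) :
    ∃ T', IsClosedOrientation D T' ∧ (∀ x y, T x y → T' x y) ∧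
      ∀ x y, Proper D x y → T' x y ∨ T' y x := by
  obtain ⟨M, hTM, hM⟩ := (Set.toFinite {T' | IsClosedOrientation D T'}).exists_le_maximal hT
  refine ⟨M, hM.1, hTM, fun x y hxy => ?_⟩
  by_contra! hc
  obtain ⟨T', hT', hle, hxy'⟩ := exists_extension hM.1 hD hxy hc.2
  exact hc.1 (hM.2 hT' hle x y hxy')

end IsClosedOrientation

/-! ### Acyclicity -/

theorem IsConsistent.improper_trans (hD : IsConsistent D) {x y z : V} (h1 : Improper D x y)
    (h2 : Improper D y z) : Improper D x z := by
  have hs : Single D x z := ⟨h1.adj_right h2.1.1, fun h => h2.1.2 (h1.adj_left h)⟩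
  refine ⟨hs, fun hn => ?_⟩
  -- The arc of the double pair is carried across both improper pairs and contradicts the single arc
  -- at `w`.
  obtain ⟨w, ⟨hw1, hw2⟩ | ⟨hw1, hw2⟩⟩ := hD.exists_path hn hs
  · exact hw1.2 (h2.adj_left (h1.adj_left hw2.2))
  · exact hw1.2 (h1.adj_right (h2.adj_right hw2.2))

/-- `f` runs through a closed walk of length `n` in the relation `T`. -/
def IsClosedWalk (T : V → V → Prop) (n : ℕ) (f : ℕ → V) : Prop :=
  f 0 = f n ∧ ∀ i < n, T (f i) (f (i + 1))

theorem exists_walk_of_transGen {T : V → V → Prop} {x y : V} (h : Relation.TransGen T x y) :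
    ∃ n, 0 < n ∧ ∃ f : ℕ → V, f 0 = x ∧ f n = y ∧ ∀ i < n, T (f i) (f (i + 1)) := by
  induction h with
  | @single y h =>
    refine ⟨1, one_pos, fun k => if k = 0 then x else y, by simp, by simp, fun i hi => ?_⟩
    obtain rfl : i = 0 := by omega
    simpa using h
  | @tail y z _ h ih =>
    obtain ⟨n, hn, f, h0, h1, hf⟩ := ih
    refine ⟨n + 1, by omega, fun k => if k ≤ n then f k else z, by simpa using h0, by simp,
      fun i hi => ?_⟩
    by_cases hin : i = n
    · subst hin
      simpa [h1] using h
    · have h2 : i ≤ n := by omega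
      have h3 : i + 1 ≤ n := by omega
      simpa [h2, h3] using hf i (by omega)

namespace IsClosedWalk

variable {T : V → V → Prop} {n : ℕ} {f : ℕ → V}

theorem segment (h : IsClosedWalk T n f) {i j : ℕ} (hij : i < j) (hj : j ≤ n)
    (e : f i = f j) : IsClosedWalk T (j - i) (fun k => f (i + k)) := by
  refine ⟨?_, fun k hk => h.2 (i + k) (by omega)⟩
  simpa [Nat.add_sub_of_le hij.le] using e

theorem cut_back (h : IsClosedWalk T n f) {i j : ℕ} (hij : i < j) (hj : j ≤ n)
    (e : T (f j) (f i)) :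
    IsClosedWalk T (j - i + 1) (fun k => if k ≤ j - i then f (i + k) else f i) := by
  refine ⟨by simp, fun k hk => ?_⟩
  by_cases hk' : k = j - i
  · subst hk'
    simpa [Nat.add_sub_of_le hij.le] using e
  · have h1 : k ≤ j - i := by omega
    have h2 : k + 1 ≤ j - i := by omega
    simpa [h1, h2, ← add_assoc] using h.2 (i + k) (by omega)

theorem cut (h : IsClosedWalk T n f) {i j : ℕ} (hij : i < j) (hj : j ≤ n)
    (e : T (f i) (f j)) :
    IsClosedWalk T (i + 1 + (n - j)) (fun k => if k ≤ i then f k else f (k - (i + 1) + j)) := by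
  refine ⟨?_, fun k hk => ?_⟩
  · have h1 : ¬ i + 1 + (n - j) ≤ i := by omega
    have h2 : i + 1 + (n - j) - (i + 1) + j = n := by omega
    simp only [h1, h2, if_false, Nat.zero_le, if_true]
    exact h.1
  · rcases lt_trichotomy k i with hk' | hk' | hk'
    · have h1 : k ≤ i := by omega
      have h2 : k + 1 ≤ i := by omega
      simpa [h1, h2] using h.2 k (by omega)
    · subst hk'
      simpa using e
    · have h1 : ¬ k ≤ i := by omega
      have h2 : ¬ k + 1 ≤ i := by omega
      have h3 : k + 1 - (i + 1) + j = k - (i + 1) + j + 1 := by omega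
      simp only [h1, h2, h3, if_false]
      exact h.2 _ (by omega)

end IsClosedWalk

/-- If all chords of a cycle of length at least five are oriented by a transitive irreflexive
relation that does not relate consecutive vertices, there is a contradiction. -/
theorem chords_contradiction {R : V → V → Prop} {n : ℕ} {f : ℕ → V} (hn : 5 ≤ n)
    (h0 : f 0 = f n) (hirr : ∀ x, ¬ R x x) (htr : ∀ x y z, R x y → R y z → R x z)
    (hR : ∀ i < n, ¬ R (f i) (f (i + 1)) ∧ ¬ R (f (i + 1)) (f i))
    (hch : ∀ i j, i + 2 ≤ j → j ≤ n → j + 2 ≤ i + n → R (f i) (f j) ∨ R (f j) (f i))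
    (h : R (f 0) (f 2)) : False := by
  -- Were the new chord directed the other way, transitivity would relate two consecutive vertices.
  -- So one end of a chord can be advanced at a time.
  have source : ∀ i j, i + 2 ≤ j → j + 1 ≤ n → j + 3 ≤ i + n → R (f i) (f j) →
      R (f i) (f (j + 1)) := by
    intro i j h1 h2 h3 hij
    refine (hch i (j + 1) (by omega) h2 (by omega)).resolve_right fun h' => ?_
    exact (hR j (by omega)).2 (htr _ _ _ h' hij)
  have sink : ∀ i j, i + 3 ≤ j → j ≤ n → j + 2 ≤ i + n → R (f i) (f j) →
      R (f (i + 1)) (f j) := by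
    intro i j h1 h2 h3 hij
    refine (hch (i + 1) j (by omega) h2 (by omega)).resolve_right fun h' => ?_
    exact (hR i (by omega)).1 (htr _ _ _ hij h')
  have h03 := source 0 2 (by omega) (by omega) (by omega) h
  have h13 := sink 0 3 (by omega) (by omega) (by omega) h03
  have h14 := source 1 3 (by omega) (by omega) (by omega) h13
  have h24 := sink 1 4 (by omega) (by omega) (by omega) h14
  -- Advancing the head as far as `f n = f 0` reverses the initial chord.
  have all : ∀ j, 4 ≤ j → j ≤ n → R (f 2) (f j) := by
    intro j hj
    induction j, hj using Nat.le_induction with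
    | base => exact fun _ => h24
    | succ j hj ih => exact fun hjn => source 2 j (by omega) hjn (by omega) (ih (by omega))
  have := all n (by omega) le_rfl
  rw [← h0] at this
  exact hirr _ (htr _ _ _ h this)

/-- In a shortest closed walk no chord is proper, since either direction would shorten the walk.
Length three contradicts closure and length four `not_four_cycle`; for greater length all chords are
improper, and improper pairs are transitive. -/
theorem IsClosedOrientation.acyclic {T : V → V → Prop} (hT : IsClosedOrientation D T)
    (hD : IsConsistent D) (htot : ∀ x y, Proper D x y → T x y ∨ T y x) (x : V) :
    ¬ Relation.TransGen T x x := by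
  intro hx
  have hex : ∃ n, 0 < n ∧ ∃ f, IsClosedWalk T n f := by
    obtain ⟨n, hn, f, h1, h2, h3⟩ := exists_walk_of_transGen hx
    exact ⟨n, hn, f, h1.trans h2.symm, h3⟩
  classical
  obtain ⟨hpos, f, hf⟩ := Nat.find_spec hex
  have hmin : ∀ m, 0 < m → m < Nat.find hex → ∀ g, ¬ IsClosedWalk T m g :=
    fun m h0 hm g hg => Nat.find_min hex hm ⟨h0, g, hg⟩
  generalize Nat.find hex = n at hpos hf hmin
  -- The bound `j + 2 ≤ i + n` excludes neighbours across the closing point of the walk.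
  have hne : ∀ i j, i + 2 ≤ j → j ≤ n → j + 2 ≤ i + n → f i ≠ f j :=
    fun i j h1 h2 h3 e => hmin _ (by omega) (by omega) _ (hf.segment (by omega) h2 e)
  have hch : ∀ i j, i + 2 ≤ j → j ≤ n → j + 2 ≤ i + n → ¬ Proper D (f i) (f j) := by
    intro i j h1 h2 h3 hp
    rcases htot _ _ hp with h | h
    · exact hmin _ (by omega) (by omega) _ (hf.cut (by omega) h2 h)
    · exact hmin _ (by omega) (by omega) _ (hf.cut_back (by omega) h2 h)
  obtain ⟨h0, hs⟩ := hf
  rcases lt_or_ge n 5 with hn | hn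
  · interval_cases n
    · have := hs 0 (by omega)
      rw [zero_add, ← h0] at this
      exact hT.asymm this this
    · have e := hs 1 (by omega)
      rw [show 1 + 1 = 2 from rfl, ← h0] at e
      exact hT.asymm (hs 0 (by omega)) e
    · have e := hs 2 (by omega)
      rw [show 2 + 1 = 3 from rfl, ← h0] at e
      exact hT.asymm e (hT.trans (hs 0 (by omega)) (hs 1 (by omega)) (hT.proper e).symm)
    · have e := hs 3 (by omega)
      rw [show 3 + 1 = 4 from rfl, ← h0] at e
      exact hT.not_four_cycle hD (hs 0 (by omega)) (hs 1 (by omega)) (hs 2 (by omega)) e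
        (hch 0 2 (by omega) (by omega) (by omega)) (hch 1 3 (by omega) (by omega) (by omega))
  · have himp : ∀ {x y}, Improper D x y → ¬ Proper D x y :=
      fun h hp => hp.elim h.2 fun h' => h.1.2 h'.2
    have hirr : ∀ x, ¬ Improper D x x := fun x h => hD.loopless x h.1.1
    have hcons : ∀ i < n, ¬ Improper D (f i) (f (i + 1)) ∧ ¬ Improper D (f (i + 1)) (f i) :=
      fun i hi => ⟨fun h => himp h (hT.proper (hs i hi)),
        fun h => himp h (hT.proper (hs i hi)).symm⟩
    have hor : ∀ i j, i + 2 ≤ j → j ≤ n → j + 2 ≤ i + n →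
        Improper D (f i) (f j) ∨ Improper D (f j) (f i) :=
      fun i j h1 h2 h3 => hD.improper_or (hne i j h1 h2 h3) (hch i j h1 h2 h3)
    rcases hor 0 2 (by omega) (by omega) (by omega) with h | h
    · exact chords_contradiction (R := Improper D) hn h0 hirr
        (fun _ _ _ => hD.improper_trans) hcons hor h
    · exact chords_contradiction (R := fun x y => Improper D y x) hn h0 hirr
        (fun _ _ _ h1 h2 => hD.improper_trans h2 h1) (fun i hi => (hcons i hi).symm)
        (fun i j h1 h2 h3 => (hor i j h1 h2 h3).symm) h

theorem exists_strictTotalOrder {T : V → V → Prop} (h : ∀ x, ¬ Relation.TransGen T x x) :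
    ∃ lt : V → V → Prop, IsStrictTotalOrder V lt ∧ ∀ x y, T x y → lt x y := by
  have hpo : IsPartialOrder V (Relation.ReflTransGen T) :=
    { refl := fun _ => .refl
      trans := fun _ _ _ => .trans
      antisymm := fun a b hab hba => by
        rcases Relation.reflTransGen_iff_eq_or_transGen.1 hab with e | hab
        · exact e.symm
        · exact absurd (hab.trans_left hba) (h a) }
  obtain ⟨s, hs, hle⟩ := extend_partialOrder (Relation.ReflTransGen T)
  refine ⟨fun x y => s x y ∧ x ≠ y, ?_, fun x y hxy => ⟨hle _ _ (.single hxy), ?_⟩⟩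
  · exact
      { trichotomous := fun a b h1 h2 => by
          by_contra hne
          rcases hs.total a b with h' | h'
          · exact h1 ⟨h', hne⟩
          · exact h2 ⟨h', Ne.symm hne⟩
        irrefl := fun a h => h.2 rfl
        trans := fun a b c h1 h2 => ⟨hs.trans _ _ _ h1.1 h2.1, by
          rintro rfl
          exact h1.2 (hs.antisymm _ _ h1.1 h2.1)⟩ }
  · rintro rfl
    exact h x (.single hxy)

/-! ### Saturated orientations -/

theorem eq_of_not_nontriv {x z x' z' : V} (h : ¬ Nontriv D x z) (hne : x ≠ z)
    (e : cls D x' z' = cls D x z) : x' = x ∧ z' = z := by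
  by_contra hc
  exact h ⟨hne, x', z', e, by tauto⟩

/-- A partial orientation by nontrivial classes that is transitive as far as pairs with
nontrivial classes are concerned. -/
structure IsSaturated (D : Digraph V) (T : V → V → Prop) : Prop
    extends IsPartialOrientation D T where
  nontriv : ∀ {x y}, T x y → Nontriv D x y
  trans : ∀ {x y z}, T x y → T y z → Nontriv D x z → T x z

namespace IsSaturated

variable {T : V → V → Prop}

theorem flip (hT : IsSaturated D T) : IsSaturated D (fun x y => T y x) where
  proper h := (hT.proper h).symm
  congr h e := hT.congr h (cls_flip e)
  asymm h := hT.asymm h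
  nontriv h := (hT.nontriv h).symm
  trans h1 h2 h := hT.trans h2 h1 h.symm

/-- The triangle lemma with apex `x` fixes the second coordinate throughout the class of `(y, z)`,
as `(x, z)` is alone in its class. If `(y, w)` were a double pair with trivial class, apex `w` would
fix the first coordinate too, against nontriviality; if improper, `(x, z)` would acquire the class
of `(x, y)`. -/
theorem trans_of_twin (hT : IsSaturated D T) (hD : IsConsistent D) {x y z w : V} (hxy : T x y)
    (hyz : T y z) (hzw : T z w) (hd : Double D x z) (hn : ¬ Nontriv D x z) : T y w := by
  by_contra hc
  have hn' : ¬ Nontriv D y w := fun h => hc (hT.trans hyz hzw h)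
  have nxz := hD.ne_of_adj hd.1
  have nyz := (hT.nontriv hyz).1
  have tri := fun {b' c' : V} => hD.triangle (b' := b') (c' := c') (hT.proper hxy) (Or.inr hd)
    (fun e => hn ((hT.nontriv hyz).congr e.symm nxz)) (hT.cls_ne_left hxy hyz).symm nyz
  by_cases hd' : Double D y w
  · obtain ⟨-, b', c', e, hne⟩ := hT.nontriv hyz
    have nyw := hD.ne_of_adj hd'.1
    have e1 := (eq_of_not_nontriv hn nxz (tri e).2).2
    have e2 := (hD.triangle (Or.inr hd'.symm) (hT.proper hzw).symm (hT.cls_ne_right hyz hzw)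
      (fun e => hn' ((hT.nontriv hyz).congr e.symm nyw)) nyz e).1
    have e3 := (eq_of_not_nontriv (fun h => hn' h.symm) nyw.symm e2).2
    tauto
  · have e := hT.cls_eq_of_not_proper hD hyz hzw fun h => h.elim hn' hd'
    exact hn ((hT.nontriv hxy).congr (tri e.symm).1 nxz)

/-- A saturated partial orientation is completed by the trivial classes it implies. -/
theorem exists_closed (hT : IsSaturated D T) (hD : IsConsistent D) {T₁ : V → V → Prop}
    (hT₁ : IsClosedOrientation D T₁) (hle : ∀ x y, T x y → T₁ x y) :
    ∃ T₀, IsClosedOrientation D T₀ ∧ (∀ x y, T x y → T₀ x y) ∧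
      ∀ x y, Nontriv D x y → T₀ x y → T x y := by
  let T₀ : V → V → Prop := fun x z =>
    T x z ∨ (Double D x z ∧ ¬ Nontriv D x z ∧ ∃ y, T x y ∧ T y z)
  have hle₀ : ∀ {x y}, T₀ x y → T₁ x y := by
    rintro x z (h | ⟨hd, -, y, h1, h2⟩)
    · exact hle _ _ h
    · exact hT₁.trans (hle _ _ h1) (hle _ _ h2) (Or.inr hd)
  have base : ∀ {x y z}, T x y → T y z → Proper D x z → T₀ x z := by
    intro x y z h1 h2 hp
    by_cases hn : Nontriv D x z
    · exact Or.inl (hT.trans h1 h2 hn)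
    · exact Or.inr ⟨hp.resolve_left hn, hn, y, h1, h2⟩
  refine ⟨T₀, ⟨⟨fun h => hT₁.proper (hle₀ h), ?_, fun h h' => hT₁.asymm (hle₀ h) (hle₀ h')⟩, ?_⟩,
    fun _ _ => Or.inl, fun x y hn h => h.resolve_right fun h' => h'.2.1 hn⟩
  · rintro x y x' y' (h | ⟨hd, hn, h⟩) e
    · exact Or.inl (hT.congr h e)
    · obtain ⟨rfl, rfl⟩ := eq_of_not_nontriv hn (hD.ne_of_adj hd.1) e
      exact Or.inr ⟨hd, hn, h⟩
  -- An added pair factors through `T`; moving the middle vertex with `trans_of_twin` turns each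
  -- composition into two steps of `T`.
  · rintro x y z (hxy | ⟨hd, hn, m, hxm, hmy⟩) (hyz | ⟨hd', hn', k, hyk, hkz⟩) hp
    · exact base hxy hyz hp
    · exact base (hT.flip.trans_of_twin hD hkz hyk hxy hd'.symm fun h => hn' h.symm) hkz hp
    · exact base hxm (hT.trans_of_twin hD hxm hmy hyz hd hn) hp
    · have hmk := hT.trans_of_twin hD hxm hmy hyk hd hn
      refine base hxm ?_ hp
      by_contra hc
      have hn₂ : ¬ Nontriv D m z := fun h => hc (hT.trans hmk hkz h)
      have nyz := hD.ne_of_adj hd'.1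
      by_cases hd₂ : Double D m z
      · have nmz := hD.ne_of_adj hd₂.1
        obtain ⟨nmy, b', c', e, hne⟩ := hT.nontriv hmy
        obtain ⟨e1, e2⟩ := hD.triangle (Or.inr hd₂.symm) (Or.inr hd'.symm)
          (fun e => hn' ((hT.nontriv hmy).congr e.symm nyz.symm).symm)
          (fun e => hn₂ ((hT.nontriv hmy).congr e.symm nmz)) nmy e
        have e3 := (eq_of_not_nontriv (fun h => hn₂ h.symm) nmz.symm e1).2
        have e4 := (eq_of_not_nontriv (fun h => hn' h.symm) nyz.symm e2).2
        tauto
      · have e := hT.cls_eq_of_not_proper hD hmk hkz fun h => h.elim hn₂ hd₂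
        have := (hD.triangle (hT.proper hyk) (Or.inr hd')
          (fun e => hn' ((hT.nontriv hkz).congr e.symm nyz)) (hT.cls_ne_left hyk hkz).symm
          (hT.nontriv hkz).1 e).2
        exact hn' ((hT.nontriv hyk).congr this.symm nyz)

end IsSaturated

/-! ### The loop invariant -/

/-- The loop invariant of the algorithm. -/
structure LoopInvariant (D : Digraph V) (T : Set (V × V)) (C : Set (Set (V × V))) : Prop where
  nontriv : ∀ {x y}, (x, y) ∈ T → Nontriv D x y
  congr : ∀ {x y x' y'}, (x, y) ∈ T → cls D x' y' = cls D x y → (x', y') ∈ T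
  consistent : ∃ T₁, IsClosedOrientation D T₁ ∧ ∀ x y, (x, y) ∈ T → T₁ x y
  undecided : ∀ {I}, I ∈ C → ∃ x y, I = cls D x y ∧ Nontriv D x y ∧ (x, y) ∉ T ∧ (y, x) ∉ T
  mem : ∀ {x y}, Nontriv D x y → (x, y) ∉ T → (y, x) ∉ T → cls D x y ∈ C

namespace LoopInvariant

variable {T : Set (V × V)} {C : Set (Set (V × V))}

theorem init (hD : IsConsistent D) :
    LoopInvariant D ∅ {I | I ∈ implicationClasses D ∧ I.Nontrivial} where
  nontriv h := h.elim
  congr h _ := h.elim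
  consistent := ⟨fun _ _ => False, ⟨⟨False.elim, fun h _ => h, fun h _ => h⟩,
    fun h _ _ => h⟩, fun _ _ h => h⟩
  undecided := by
    rintro I ⟨⟨⟨x, y⟩, hp, rfl⟩, p, hp1, q, hq, hpq⟩
    have hne : x ≠ y := by
      rintro rfl
      rcases hp with hp | hp <;> exact hD.loopless _ hp
    refine ⟨x, y, rfl, ⟨hne, ?_⟩, fun h => h, fun h => h⟩
    by_contra! hc
    have h1 := hc p.1 p.2 (cls_eq_of_transGen hp1).symm
    have h2 := hc q.1 q.2 (cls_eq_of_transGen hq).symm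
    exact hpq (Prod.ext (h1.1.trans h2.1.symm) (h1.2.trans h2.2.symm))
  mem {x y} h _ _ := by
    obtain ⟨hne, x', y', e, h⟩ := h
    refine ⟨⟨(x, y), hD.total x y hne, rfl⟩, (x', y'), ?_, (x, y), hD.mem_cls hne, ?_⟩
    · exact hD.transGen_of_cls_eq e.symm (hD.ne_of_cls_eq e hne)
    · rw [ne_eq, Prod.mk.injEq]
      tauto

theorem isPartialOrientation (h : LoopInvariant D T C) :
    IsPartialOrientation D (fun x y => (x, y) ∈ T) where
  proper hxy := Or.inl (h.nontriv hxy)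
  congr := h.congr
  asymm hxy hyx := by
    obtain ⟨T₁, hT₁, hle⟩ := h.consistent
    exact hT₁.asymm (hle _ _ hxy) (hle _ _ hyx)

/-- Only a closed orientation containing both `T` and the chosen class has to be supplied; forced
and free choices differ in how it is found. -/
theorem step (h : LoopInvariant D T C) (hD : IsConsistent D) {u v : V} (huv : Nontriv D u v)
    (hc : ∃ T₁, IsClosedOrientation D T₁ ∧ (∀ x y, (x, y) ∈ T → T₁ x y) ∧ T₁ u v) :
    LoopInvariant D (T ∪ cls D u v) (C \ {cls D u v, inverse (cls D u v)}) where
  nontriv {x y} hxy := by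
    rcases hxy with hxy | hxy
    · exact h.nontriv hxy
    · have e := cls_eq_of_transGen hxy
      exact huv.congr e.symm (hD.ne_of_cls_eq e.symm huv.1)
  congr {x y x' y'} hxy e := by
    rcases hxy with hxy | hxy
    · exact Or.inl (h.congr hxy e)
    · have e' := e.trans (cls_eq_of_transGen hxy).symm
      exact Or.inr (hD.transGen_of_cls_eq e'.symm (hD.ne_of_cls_eq e' huv.1))
  consistent := by
    obtain ⟨T₁, hT₁, hle, huv₁⟩ := hc
    refine ⟨T₁, hT₁, fun x y hxy => ?_⟩
    rcases hxy with hxy | hxy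
    · exact hle _ _ hxy
    · exact hT₁.congr huv₁ (cls_eq_of_transGen hxy).symm
  undecided {I} hI := by
    obtain ⟨hI, hI'⟩ := hI
    obtain ⟨x, y, rfl, hn, h1, h2⟩ := h.undecided hI
    refine ⟨x, y, rfl, hn, ?_, ?_⟩
    · rintro (h3 | h3)
      · exact h1 h3
      · exact hI' (Or.inl (cls_eq_of_transGen h3).symm)
    · rintro (h3 | h3)
      · exact h2 h3
      · refine hI' (Or.inr ?_)
        rw [Set.mem_singleton_iff, ← cls_swap]
        exact (cls_flip (cls_eq_of_transGen h3)).symm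
  mem {x y} hn h1 h2 := by
    refine ⟨h.mem hn (fun h3 => h1 (Or.inl h3)) (fun h3 => h2 (Or.inl h3)), ?_⟩
    rintro (h3 | h3)
    · exact h1 (Or.inr (h3 ▸ hD.mem_cls hn.1))
    · rw [Set.mem_singleton_iff, ← cls_swap] at h3
      exact h2 (Or.inr (cls_flip h3 ▸ hD.mem_cls hn.1.symm))

/-- Transitivity puts the chosen class into every closed orientation containing `T`. -/
theorem forced (h : LoopInvariant D T C) (hD : IsConsistent D) {I : Set (V × V)} (hI : I ∈ C)
    (hf : ForcedBy T I) : LoopInvariant D (T ∪ I) (C \ {I, inverse I}) := by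
  obtain ⟨u, v, rfl, hn, -, -⟩ := h.undecided hI
  refine h.step hD hn ?_
  obtain ⟨T₁, hT₁, hle⟩ := h.consistent
  obtain ⟨x, y, z, hxy, hyz, hxz⟩ := hf
  have e := cls_eq_of_transGen hxz
  refine ⟨T₁, hT₁, hle, hT₁.congr (hT₁.trans (hle _ _ hxy) (hle _ _ hyz) (Or.inl ?_)) e⟩
  exact hn.congr e.symm (hD.ne_of_cls_eq e.symm hn.1)

theorem isSaturated (h : LoopInvariant D T C) (hD : IsConsistent D)
    (hf : ¬ ∃ J ∈ C, ForcedBy T J) : IsSaturated D (fun x y => (x, y) ∈ T) where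
  toIsPartialOrientation := h.isPartialOrientation
  nontriv := h.nontriv
  trans {x y z} hxy hyz hn := by
    by_contra hxz
    by_cases hzx : (z, x) ∈ T
    · obtain ⟨T₁, hT₁, hle⟩ := h.consistent
      exact hT₁.asymm (hle _ _ hzx) (hT₁.trans (hle _ _ hxy) (hle _ _ hyz) (Or.inl hn))
    · exact hf ⟨_, h.mem hn hxz hzx, x, y, z, hxy, hyz, hD.mem_cls hn.1⟩

/-- The closed completion of the saturated `T` has no new nontrivial pairs, so it leaves `(v, u)`
out and can be extended by `(u, v)`. -/
theorem free (h : LoopInvariant D T C) (hD : IsConsistent D) {I : Set (V × V)} (hI : I ∈ C)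
    (hf : ¬ ∃ J ∈ C, ForcedBy T J) : LoopInvariant D (T ∪ I) (C \ {I, inverse I}) := by
  obtain ⟨u, v, rfl, hn, -, hvu⟩ := h.undecided hI
  refine h.step hD hn ?_
  obtain ⟨T₁, hT₁, hle⟩ := h.consistent
  obtain ⟨T₀, hT₀, hle₀, hn₀⟩ := (h.isSaturated hD hf).exists_closed hD hT₁ hle
  obtain ⟨T₂, hT₂, hle₂, huv⟩ :=
    hT₀.exists_extension hD (Or.inl hn) fun h' => hvu (hn₀ _ _ hn.symm h')
  exact ⟨T₂, hT₂, fun x y hxy => hle₂ _ _ (hle₀ _ _ hxy), huv⟩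

theorem exists_order [Finite V] (h : LoopInvariant D T C) (hD : IsConsistent D) :
    ∃ lt : V → V → Prop, IsStrictTotalOrder V lt ∧ ∀ x y, (x, y) ∈ T → lt x y := by
  obtain ⟨T₁, hT₁, hle⟩ := h.consistent
  obtain ⟨T₂, hT₂, hle₂, htot⟩ := hT₁.exists_total hD
  obtain ⟨lt, hlt, hle₃⟩ := exists_strictTotalOrder (hT₂.acyclic hD htot)
  exact ⟨lt, hlt, fun x y hxy => hle₃ _ _ (hle₂ _ _ (hle _ _ hxy))⟩

theorem isComparabilityOrdering (h : LoopInvariant D T ∅) {lt : V → V → Prop}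
    (hlt : IsStrictTotalOrder V lt) (hle : ∀ x y, (x, y) ∈ T → lt x y) :
    IsComparabilityOrdering D lt := by
  -- Equal classes would make `(y, x)` nontrivial, hence decided by `T`; either decision puts `x`
  -- and `z` on the same side of `y`.
  have key : ∀ x y z, lt x y → lt y z → cls D y x ≠ cls D y z := by
    intro x y z hxy hyz e
    have nyx : y ≠ x := by
      rintro rfl
      exact hlt.irrefl _ hxy
    have nzx : z ≠ x := by
      rintro rfl
      exact hlt.irrefl _ (hlt.trans _ _ _ hxy hyz)
    have hn : Nontriv D y x := ⟨nyx, y, z, e.symm, Or.inr nzx⟩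
    by_cases h1 : (y, x) ∈ T
    · exact hlt.irrefl _ (hlt.trans _ _ _ hxy (hle _ _ h1))
    · by_cases h2 : (x, y) ∈ T
      · exact hlt.irrefl _ (hlt.trans _ _ _ hyz (hle _ _ (h.congr h2 (cls_flip e).symm)))
      · exact h.mem hn h1 h2
  refine ⟨hlt, fun x y z hxy hyz h1 h2 => ?_, fun x y z hxy hyz h1 h2 => ?_⟩
  · by_contra hc
    exact key x y z hxy hyz (cls_eq_of_adj h1 h2 hc)
  · by_contra hc
    exact key x y z hxy hyz (cls_eq_of_adj h1 h2 hc).symm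

end LoopInvariant

/-! ### Runs of the algorithm -/

/-- What holds in every reachable state. -/
def StateInvariant (D : Digraph V) : State V → Prop
  | .start => True
  | .loop T C => LoopInvariant D T C
  | .rejected => False
  | .returned lt => IsComparabilityOrdering D lt

theorem Step.stateInvariant (hD : IsConsistent D)
    (hI : ∀ I ∈ implicationClasses D, I ≠ inverse I) {s s' : State V} (h : Step D s s')
    (hs : StateInvariant D s) : StateInvariant D s' := by
  cases h with
  | reject h =>
    obtain ⟨I, h1, h2⟩ := h
    exact hI I h1 h2
  | init _ => exact LoopInvariant.init hD
  | forced T C I hI h => exact LoopInvariant.forced hs hD hI h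
  | free T C I hI h => exact LoopInvariant.free hs hD hI h
  | finish T lt hlt h => exact LoopInvariant.isComparabilityOrdering hs hlt h

theorem exists_step_or_returned [Finite V] (hD : IsConsistent D)
    (hI : ∀ I ∈ implicationClasses D, I ≠ inverse I) {s : State V} (hs : StateInvariant D s) :
    (∃ s', Step D s s') ∨ ∃ lt, s = .returned lt ∧ IsComparabilityOrdering D lt := by
  cases s with
  | start => exact Or.inl ⟨_, .init fun ⟨I, h1, h2⟩ => hI I h1 h2⟩
  | rejected => exact hs.elim
  | returned lt => exact Or.inr ⟨lt, rfl, hs⟩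
  | loop T C =>
    left
    rcases C.eq_empty_or_nonempty with rfl | ⟨I, hIC⟩
    · obtain ⟨lt, hlt, hle⟩ := LoopInvariant.exists_order hs hD
      exact ⟨_, .finish T lt hlt hle⟩
    · by_cases hf : ∃ J ∈ C, ForcedBy T J
      · obtain ⟨J, hJ, hf⟩ := hf
        exact ⟨_, .forced T C J hJ hf⟩
      · exact ⟨_, .free T C I hIC hf⟩

/-- A bound for the number of steps that remain. -/
noncomputable def stepBound : State V → ℕ
  -- All sets of pairs bound the initial number of classes; the extra unit pays for the initial
  -- step.
  | .start => (Set.univ : Set (Set (V × V))).ncard + 2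
  | .loop _ C => C.ncard + 1
  | .rejected => 0
  | .returned _ => 0

theorem Step.stepBound_lt [Finite V] {s s' : State V} (h : Step D s s') :
    stepBound s' < stepBound s := by
  have key : ∀ (C : Set (Set (V × V))) (I), I ∈ C →
      (C \ {I, inverse I}).ncard + 1 < C.ncard + 1 := by
    intro C I hI
    refine Nat.succ_lt_succ (Set.ncard_lt_ncard ?_ (Set.toFinite _))
    exact ⟨Set.sdiff_subset, fun h => (h hI).2 (Or.inl rfl)⟩
  cases h with
  | reject _ => exact Nat.succ_pos _
  | init _ =>
    have := Set.ncard_le_ncard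
      (Set.subset_univ {I | I ∈ implicationClasses D ∧ I.Nontrivial}) (Set.toFinite _)
    simp only [stepBound]
    omega
  | forced T C I hI h => exact key C I hI
  | free T C I hI h => exact key C I hI
  | finish T lt hlt h => exact Nat.succ_pos _

theorem isConsistent_of_ne_inverse (hD : IsSemicomplete D)
    (hI : ∀ I ∈ implicationClasses D, I ≠ inverse I) : IsConsistent D where
  toIsSemicomplete := hD
  cls_ne x y h := by
    rw [cls_swap x y]
    exact hI _ ⟨(x, y), hD.total x y h, rfl⟩

end ComparabilityDigraph

/-- On a finite semicomplete digraph without an implication class that equals its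
inverse: no run of the algorithm is infinite; every run that cannot be continued has
returned a comparability ordering (so no run rejects or gets stuck, whatever choices
are made); and the digraph is a comparability digraph. -/
theorem mainTheorem4 {V : Type*} [Finite V] (D : Digraph V)
    (hD : ComparabilityDigraph.IsSemicomplete D)
    (hI : ∀ I ∈ ComparabilityDigraph.implicationClasses D,
      I ≠ ComparabilityDigraph.inverse I) :
    (¬ ∃ run : ℕ → ComparabilityDigraph.State V,
        run 0 = .start ∧ ∀ n, ComparabilityDigraph.Step D (run n) (run (n + 1))) ∧
    (∀ s : ComparabilityDigraph.State V,
        Relation.ReflTransGen (ComparabilityDigraph.Step D) .start s →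
        (¬ ∃ s', ComparabilityDigraph.Step D s s') →
        ∃ lt : V → V → Prop, s = .returned lt ∧
          ComparabilityDigraph.IsComparabilityOrdering D lt) ∧
    ComparabilityDigraph.IsComparabilityDigraph D := by
  have hC := ComparabilityDigraph.isConsistent_of_ne_inverse hD hI
  have hinv : ∀ s, Relation.ReflTransGen (ComparabilityDigraph.Step D) .start s →
      ComparabilityDigraph.StateInvariant D s := by
    intro s hs
    induction hs with
    | refl => trivial
    | tail _ h ih => exact h.stateInvariant hC hI ih
  have hfinal : ∀ s, Relation.ReflTransGen (ComparabilityDigraph.Step D) .start s →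
      (¬ ∃ s', ComparabilityDigraph.Step D s s') →
      ∃ lt : V → V → Prop, s = .returned lt ∧
        ComparabilityDigraph.IsComparabilityOrdering D lt := fun s hs hstep =>
    (ComparabilityDigraph.exists_step_or_returned hC hI (hinv s hs)).resolve_left hstep
  refine ⟨?_, hfinal, ?_⟩
  · rintro ⟨run, -, hrun⟩
    have hanti : StrictAnti fun n => ComparabilityDigraph.stepBound (run n) :=
      strictAnti_nat_of_succ_lt fun n => (hrun n).stepBound_lt
    exact not_strictAnti_of_wellFoundedLT _ hanti
  -- A reachable state of least bound has no successor, so it has returned an ordering.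
  · obtain ⟨s, hs, hmin⟩ := (measure ComparabilityDigraph.stepBound).wf.has_min
      {s | Relation.ReflTransGen (ComparabilityDigraph.Step D) .start s} ⟨_, .refl⟩
    obtain ⟨lt, -, hlt⟩ := hfinal s hs fun ⟨s', h⟩ => hmin s' (hs.tail h) h.stepBound_lt
    exact ⟨lt, hlt⟩
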